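/- Let $m \ge 2$ be an integer, $\mu \in \mathbb{R}\setminus\{0\}$, and let $D \subset \mathbb{R}^m$ be a domain (a non-empty connected open set). Let $u$ be $\mu$-panharmonic in $D$, that is, a real-valued function $u \in C^2(D)$ with $\nabla^2 u - \mu^2 u = 0$ in $D$. For $x\in\mathbb{R}^m$ and $r>0$ put $B_r(x)=\{y : |y-x|<r\}$ and call this ball admissible if $\overline{B_r(x)} \subset D$. Let $$M^\bullet(u,x,r) = \frac{1}{|B_r|}\int_{B_r(x)} u(y)\,dy, \qquad M^\circ(u,x,r) = \frac{1}{\omega_m}\int_{S_1(0)} u(x+ry)\,dS_y$$ be the means of $u$ over the ball $B_r(x)$ and over its boundary sphere; here $|B_r|$ is the volume of $B_r(x)$, $S_1(0)$ is the unit sphere, $dS$ its surface area measure and $\omega_m$ its total area. For real $t \neq 0$ let $$a^\circ(t) = \Gamma\!\left(\frac m2\right)\frac{I_{(m-2)/2}(t)}{(t/2)^{(m-2)/2}}, \qquad a^\bullet(t) = \Gamma\!\left(\frac m2+1\right)\frac{I_{m/2}(t)}{(t/2)^{m/2}},$$ where $I_\nu(z) = (z/2)^\nu\sum_{k=0}^\infty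 \frac{(z/2)^{2k}}{k!\,\Gamma(\nu+k+1)}$ is the modified Bessel function of the first kind (for $t<0$ all powers with the principal branch, which cancels in the quotients). Then, for every admissible ball $B_r(x)$, $$M^\bullet(u,x,r) = a^\bullet(\mu r)\,u(x) \qquad\text{and}\qquad a^\circ(\mu r)\,M^\bullet(u,x,r) = a^\bullet(\mu r)\,M^\circ(u,x,r).$$ -/

import Mathlib

open MeasureTheory Metric
open scoped InnerProductSpace Laplacian

noncomputable section

namespace Panharmonic

/-- The modified Bessel function of the first kind
`I_ν(z) = (z/2)^ν ∑_k (z/2)^(2k) / (k! Γ(ν + k + 1))`, with the principal branch of the power.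
(`Complex.Gamma` is `0` at its poles, so that `1/Γ` vanishes there, as it should.)
The argument is complex so that `I_ν(t)` makes sense also at negative real `t`. -/
def besselI (ν z : ℂ) : ℂ :=
  (z / 2) ^ ν * ∑' k : ℕ, (z / 2) ^ (2 * k) / ((k.factorial : ℂ) * Complex.Gamma (ν + k + 1))

/-- The coefficient `a°(t) = Γ(m/2) I_{(m-2)/2}(t) / (t/2)^{(m-2)/2}` of the spherical mean,
for real `t ≠ 0`. The branch of the power cancels in the quotient. -/
def aSphere (m : ℕ) (t : ℝ) : ℂ :=
  Complex.Gamma ((m : ℂ) / 2) * besselI (((m : ℂ) - 2) / 2) t / ((t : ℂ) / 2) ^ (((m : ℂ) - 2) / 2)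

/-- The coefficient `a•(t) = Γ(m/2 + 1) I_{m/2}(t) / (t/2)^{m/2}` of the ball mean,
for real `t ≠ 0`. The branch of the power cancels in the quotient. -/
def aBall (m : ℕ) (t : ℝ) : ℂ :=
  Complex.Gamma ((m : ℂ) / 2 + 1) * besselI ((m : ℂ) / 2) t / ((t : ℂ) / 2) ^ ((m : ℂ) / 2)

/-- `u` is `μ`-panharmonic in the open set `D`: it is a real-valued `C²` solution in `D` of the
modified Helmholtz equation `∇²u - μ²u = 0`. -/
def IsPanharmonicOn {m : ℕ} (μ : ℝ) (u : EuclideanSpace ℝ (Fin m) → ℝ)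
    (D : Set (EuclideanSpace ℝ (Fin m))) : Prop :=
  ContDiffOn ℝ 2 u D ∧ ∀ x ∈ D, (Δ u) x - μ ^ 2 * u x = 0

/-- The open ball `B_r(x)`, `r > 0`, is admissible with respect to `D` if its closure is
contained in `D`. -/
def IsAdmissibleBall {m : ℕ} (D : Set (EuclideanSpace ℝ (Fin m)))
    (x : EuclideanSpace ℝ (Fin m)) (r : ℝ) : Prop :=
  0 < r ∧ closure (ball x r) ⊆ D

/-- The volume mean `M•(u, x, r) = |B_r|⁻¹ ∫_{B_r(x)} u(y) dy`. -/
def ballMean {m : ℕ} (u : EuclideanSpace ℝ (Fin m) → ℝ) (x : EuclideanSpace ℝ (Fin m))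
    (r : ℝ) : ℝ :=
  ⨍ y in ball x r, u y

/-- The spherical mean `M°(u, x, r) = ω_m⁻¹ ∫_{S_1(0)} u(x + r y) dS_y`, where `dS` is the surface
area measure of the unit sphere and `ω_m` its total area. -/
def sphereMean {m : ℕ} (u : EuclideanSpace ℝ (Fin m) → ℝ) (x : EuclideanSpace ℝ (Fin m))
    (r : ℝ) : ℝ :=
  ⨍ y : sphere (0 : EuclideanSpace ℝ (Fin m)) 1, u (x + r • (y : EuclideanSpace ℝ (Fin m)))
    ∂(volume : Measure (EuclideanSpace ℝ (Fin m))).toSphere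

end Panharmonic

end

/-!
Translate the centre of the ball to `0` and multiply `u` by a cutoff, so that `u` becomes a compactly
supported `C²` function `v` on the whole space with `Δ v = μ² v` on the ball. Let `φ s` be the
integral of `v (s ω)` over unit vectors `ω`. The divergence theorem for `∇v` on balls says
`s ^ (m - 1) φ' s = μ² ∫₀ˢ t ^ (m - 1) φ t dt`.

Mathlib has the divergence theorem on boxes only, so it is derived here from integration by parts
for Lipschitz functions: the weight `max (ρ² - ‖y‖²) 0` is Lipschitz with compact support, so
`∫ (ρ² - ‖y‖²) Δv = 2 ∫ ∇v · y` over the ball of radius `ρ`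
(`integral_sq_sub_norm_sq_mul_laplacian`). In polar coordinates both sides are integrals over
`0 < s < ρ`, and differentiating in `ρ` gives the radial equation (`pow_mul_deriv_sphereIntegral`).

The coefficients are `a°(t) = Γ(m/2) ₀F̃₁(m/2; t²/4)` and `a•(t) = Γ(m/2 + 1) ₀F̃₁(m/2 + 1; t²/4)`,
where `₀F̃₁(a; z) = ∑ z ^ k / (k! Γ(a + k))` has derivative `₀F̃₁(a + 1; z)` and satisfies
`₀F̃₁(a; z) = a ₀F̃₁(a + 1; z) + z ₀F̃₁(a + 2; z)`. Hence, as functions of `s`,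
`a°(μs)' = μ² s a•(μs) / m` and `(s ^ m a•(μs))' = m s ^ (m - 1) a°(μs)`: the function `a°(μs)`
solves the radial equation with value `1` at `0`. The Wronskian of `φ` and `a°(μ ·)` vanishes, which
is the ratio of the two means, and so `φ / a°(μ ·)` is constant, because `a° > 0`
(`radial_solution`). Together these give the spherical mean `a°(μr) u(x)` and the ball mean
`a•(μr) u(x)`.
-/

namespace Panharmonic

/-! ### The series of the modified Bessel functions -/

/-- The regularised confluent hypergeometric limit function
`₀F̃₁(a; z) = ∑_k z ^ k / (k! Γ(a + k))`, for real `a` and `z`. -/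
noncomputable def reg0F1 (a z : ℝ) : ℝ :=
  ∑' k : ℕ, z ^ k / ((k.factorial : ℝ) * Real.Gamma (a + k))

lemma Gamma_le_Gamma_add_nat {a : ℝ} (ha : 1 ≤ a) (k : ℕ) :
    Real.Gamma a ≤ Real.Gamma (a + k) := by
  induction k with
  | zero => simp
  | succ k ih =>
    have hk : (0 : ℝ) ≤ k := k.cast_nonneg
    have h0 : 0 < Real.Gamma (a + k) := Real.Gamma_pos_of_pos (by linarith)
    rw [Nat.cast_succ, ← add_assoc, Real.Gamma_add_one (by linarith)]
    nlinarith

lemma Gamma_add_nat_pos {a : ℝ} (ha : 1 ≤ a) (k : ℕ) : 0 < Real.Gamma (a + k) :=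
  Real.Gamma_pos_of_pos (by positivity)

/-- For `1 ≤ a` the factors `1 / Γ(a + k)` are at most `1 / Γ(a)`, so that the exponential series
dominates. -/
lemma summable_reg0F1 {a : ℝ} (ha : 1 ≤ a) (z : ℝ) :
    Summable fun k : ℕ ↦ z ^ k / ((k.factorial : ℝ) * Real.Gamma (a + k)) := by
  refine .of_norm_bounded ((Real.summable_pow_div_factorial |z|).div_const (Real.Gamma a))
    fun k ↦ ?_
  have h0 : 0 < Real.Gamma a := by simpa using Gamma_add_nat_pos ha 0
  rw [norm_div, norm_pow, Real.norm_eq_abs, Real.norm_of_nonneg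
    (mul_nonneg (by positivity) (Gamma_add_nat_pos ha k).le), div_div]
  gcongr
  exact Gamma_le_Gamma_add_nat ha k

lemma reg0F1_pos {a z : ℝ} (ha : 1 ≤ a) (hz : 0 ≤ z) : 0 < reg0F1 a z := by
  refine (summable_reg0F1 ha z).tsum_pos (fun k ↦ ?_) 0 ?_
  · exact div_nonneg (pow_nonneg hz k) (mul_nonneg (by positivity) (Gamma_add_nat_pos ha k).le)
  · have := Gamma_add_nat_pos ha 0
    simp only [pow_zero, Nat.factorial_zero, Nat.cast_one, one_mul]
    positivity

lemma reg0F1_zero (a : ℝ) : reg0F1 a 0 = (Real.Gamma a)⁻¹ := by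
  rw [reg0F1, tsum_eq_single 0 fun k hk ↦ by simp [hk]]
  simp

/-- Termwise differentiation shifts the parameter: `d/dz ₀F̃₁(a; z) = ₀F̃₁(a + 1; z)`. -/
lemma hasDerivAt_reg0F1 {a : ℝ} (ha : 1 ≤ a) (z : ℝ) :
    HasDerivAt (reg0F1 a) (reg0F1 (a + 1) z) z := by
  have h0 : 0 < Real.Gamma a := by simpa using Gamma_add_nat_pos ha 0
  set R : ℝ := |z| + 1
  have hR : 0 ≤ R := by positivity
  -- The derivative of term `k + 1` is term `k` of the series with parameter `a + 1`.
  have hsucc (y : ℝ) (k : ℕ) : ((k + 1 : ℕ) : ℝ) * y ^ (k + 1 - 1) /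
      (((k + 1).factorial : ℝ) * Real.Gamma (a + (k + 1 : ℕ))) =
      y ^ k / ((k.factorial : ℝ) * Real.Gamma (a + 1 + k)) := by
    have : Real.Gamma (a + 1 + k) ≠ 0 := (Gamma_add_nat_pos (by linarith) k).ne'
    rw [Nat.factorial_succ, Nat.add_sub_cancel,
      show a + ((k + 1 : ℕ) : ℝ) = a + 1 + k by push_cast; ring]
    push_cast
    field_simp
  have hu : Summable fun k : ℕ ↦ (k : ℝ) * R ^ (k - 1) / ((k.factorial : ℝ) * Real.Gamma a) := by
    refine (summable_nat_add_iff 1).1 ?_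
    refine ((Real.summable_pow_div_factorial R).div_const (Real.Gamma a)).congr fun k ↦ ?_
    rw [Nat.factorial_succ, Nat.add_sub_cancel]
    push_cast
    field_simp
  have key := hasDerivAt_tsum_of_isPreconnected (t := ball (0 : ℝ) R) (y₀ := 0) (y := z)
    (g := fun (k : ℕ) (y : ℝ) ↦ y ^ k / ((k.factorial : ℝ) * Real.Gamma (a + k)))
    (g' := fun (k : ℕ) (y : ℝ) ↦ (k : ℝ) * y ^ (k - 1) /
      ((k.factorial : ℝ) * Real.Gamma (a + k))) hu isOpen_ball
    (convex_ball 0 R).isPreconnected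
    (fun k y _ ↦ (hasDerivAt_pow k y).div_const _) ?_ (mem_ball_self (by positivity))
    (summable_reg0F1 ha 0) (by simp [R])
  · refine key.congr_deriv ?_
    have hs : Summable fun k : ℕ ↦ (k : ℝ) * z ^ (k - 1) /
        ((k.factorial : ℝ) * Real.Gamma (a + k)) := by
      refine (summable_nat_add_iff 1).1 ?_
      simpa only [hsucc] using summable_reg0F1 (by linarith : 1 ≤ a + 1) z
    rw [hs.tsum_eq_zero_add]
    simp only [hsucc, reg0F1]
    simp
  · intro k y hy
    rw [norm_div, norm_mul, norm_pow, Real.norm_of_nonneg (Nat.cast_nonneg k),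
      Real.norm_of_nonneg (mul_nonneg (by positivity) (Gamma_add_nat_pos ha k).le)]
    have hyR : ‖y‖ ≤ R := (mem_ball_zero_iff.1 hy).le
    gcongr
    exact Gamma_le_Gamma_add_nat ha k

/-- The contiguous relation `₀F̃₁(a; z) = a ₀F̃₁(a + 1; z) + z ₀F̃₁(a + 2; z)`. -/
lemma reg0F1_contiguous {a : ℝ} (ha : 1 ≤ a) (z : ℝ) :
    reg0F1 a z = a * reg0F1 (a + 1) z + z * reg0F1 (a + 1 + 1) z := by
  have h1 := summable_reg0F1 (by linarith : 1 ≤ a + 1) z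
  have h2 := summable_reg0F1 (by linarith : 1 ≤ a + 1 + 1) z
  have hG (k : ℕ) : Real.Gamma (a + 1 + k) = (a + k) * Real.Gamma (a + k) := by
    rw [add_right_comm, Real.Gamma_add_one (by positivity)]
  have ha0 : Real.Gamma a ≠ 0 := by simpa using (Gamma_add_nat_pos ha 0).ne'
  rw [reg0F1, reg0F1, reg0F1, (summable_reg0F1 ha z).tsum_eq_zero_add, h1.tsum_eq_zero_add,
    mul_add, ← tsum_mul_left, ← tsum_mul_left, add_assoc,
    ← (((summable_nat_add_iff 1).2 h1).mul_left a).tsum_add (h2.mul_left z)]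
  congr 1
  · simp [Real.Gamma_add_one (by linarith : a ≠ 0)]
    field_simp
  · refine tsum_congr fun k ↦ ?_
    have h3 := (Gamma_add_nat_pos ha (k + 1)).ne'
    rw [show a + 1 + 1 + (k : ℝ) = a + 1 + (k + 1 : ℕ) by push_cast; ring, hG,
      Nat.factorial_succ]
    have h4 : a + ((k + 1 : ℕ) : ℝ) ≠ 0 := by positivity
    push_cast at h3 h4 ⊢
    field_simp
    ring

/-! ### The coefficients of the mean value identities -/

/-- The real form of `aSphere m`: the entire function `Γ(m/2) ₀F̃₁(m/2; t²/4)`, which unlike the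
quotient of Bessel function and power is also meaningful at `t = 0`. -/
noncomputable def sphereCoeff (m : ℕ) (t : ℝ) : ℝ :=
  Real.Gamma (m / 2) * reg0F1 (m / 2) ((t / 2) ^ 2)

/-- The real form of `aBall m`: the entire function `Γ(m/2 + 1) ₀F̃₁(m/2 + 1; t²/4)`. -/
noncomputable def ballCoeff (m : ℕ) (t : ℝ) : ℝ :=
  Real.Gamma (m / 2 + 1) * reg0F1 (m / 2 + 1) ((t / 2) ^ 2)

lemma tsum_besselI_eq_reg0F1 (a t : ℝ) :
    ∑' k : ℕ, ((t : ℂ) / 2) ^ (2 * k) / ((k.factorial : ℂ) * Complex.Gamma ((a : ℂ) + k)) =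
      (reg0F1 a ((t / 2) ^ 2) : ℂ) := by
  rw [reg0F1, Complex.ofReal_tsum]
  refine tsum_congr fun k ↦ ?_
  push_cast
  rw [← Complex.Gamma_ofReal, pow_mul]
  push_cast
  rfl

lemma aSphere_eq_sphereCoeff (m : ℕ) {t : ℝ} (ht : t ≠ 0) :
    aSphere m t = (sphereCoeff m t : ℂ) := by
  have h0 : ((t : ℂ) / 2) ^ (((m : ℂ) - 2) / 2) ≠ 0 := by
    simp [Complex.cpow_eq_zero_iff, ht]
  have := tsum_besselI_eq_reg0F1 (m / 2) t
  rw [aSphere, besselI, sphereCoeff, Complex.ofReal_mul, ← this, ← Complex.Gamma_ofReal,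
    mul_left_comm, mul_div_cancel_left₀ _ h0]
  push_cast
  congr 1
  refine tsum_congr fun k ↦ ?_
  rw [show ((m : ℂ) - 2) / 2 + k + 1 = m / 2 + k by ring]

lemma aBall_eq_ballCoeff (m : ℕ) {t : ℝ} (ht : t ≠ 0) :
    aBall m t = (ballCoeff m t : ℂ) := by
  have h0 : ((t : ℂ) / 2) ^ ((m : ℂ) / 2) ≠ 0 := by
    simp [Complex.cpow_eq_zero_iff, ht]
  have := tsum_besselI_eq_reg0F1 (m / 2 + 1) t
  rw [aBall, besselI, ballCoeff, Complex.ofReal_mul, ← this, ← Complex.Gamma_ofReal,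
    mul_left_comm, mul_div_cancel_left₀ _ h0]
  push_cast
  congr 1
  refine tsum_congr fun k ↦ ?_
  rw [add_right_comm]

lemma one_le_half_natCast {m : ℕ} (hm : 2 ≤ m) : (1 : ℝ) ≤ m / 2 := by
  have : (2 : ℝ) ≤ m := by exact_mod_cast hm
  linarith

lemma sphereCoeff_pos {m : ℕ} (hm : 2 ≤ m) (t : ℝ) : 0 < sphereCoeff m t :=
  mul_pos (Real.Gamma_pos_of_pos (by linarith [one_le_half_natCast hm]))
    (reg0F1_pos (one_le_half_natCast hm) (sq_nonneg _))

lemma sphereCoeff_zero {m : ℕ} (hm : 2 ≤ m) : sphereCoeff m 0 = 1 := by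
  have := Real.Gamma_pos_of_pos (by linarith [one_le_half_natCast hm] : (0 : ℝ) < m / 2)
  simp [sphereCoeff, reg0F1_zero, this.ne']

lemma hasDerivAt_sphereCoeff {m : ℕ} (hm : 2 ≤ m) (μ s : ℝ) :
    HasDerivAt (fun s ↦ sphereCoeff m (μ * s)) (μ ^ 2 * s * ballCoeff m (μ * s) / m) s := by
  have h1 := one_le_half_natCast hm
  have hq : HasDerivAt (fun s : ℝ ↦ (μ * s / 2) ^ 2) (μ ^ 2 * s / 2) s := by
    refine ((((hasDerivAt_id s).const_mul μ).div_const 2).pow 2).congr_deriv ?_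
    simp; ring
  refine (((hasDerivAt_reg0F1 h1 _).comp s hq).const_mul (Real.Gamma (m / 2))).congr_deriv ?_
  have : (m : ℝ) ≠ 0 := by positivity
  rw [ballCoeff, Real.Gamma_add_one (by linarith)]
  field_simp

lemma hasDerivAt_pow_mul_ballCoeff {m : ℕ} (hm : 2 ≤ m) (μ s : ℝ) :
    HasDerivAt (fun s ↦ s ^ m * ballCoeff m (μ * s))
      (m * s ^ (m - 1) * sphereCoeff m (μ * s)) s := by
  have h1 := one_le_half_natCast hm
  have hq : HasDerivAt (fun s : ℝ ↦ (μ * s / 2) ^ 2) (μ ^ 2 * s / 2) s := by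
    refine ((((hasDerivAt_id s).const_mul μ).div_const 2).pow 2).congr_deriv ?_
    simp; ring
  refine ((hasDerivAt_pow m s).mul (((hasDerivAt_reg0F1 (by linarith : (1 : ℝ) ≤ m / 2 + 1)
    _).comp s hq).const_mul (Real.Gamma (m / 2 + 1)))).congr_deriv ?_
  rw [sphereCoeff, reg0F1_contiguous h1, Real.Gamma_add_one (by linarith)]
  obtain ⟨n, rfl⟩ : ∃ n, m = n + 1 := ⟨m - 1, by omega⟩
  simp only [Nat.add_sub_cancel, Function.comp_apply]
  ring

open Set Filter Topology

/-! ### The weight `max (ρ² - ‖y‖²) 0` -/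

lemma lipschitzWith_max_sq_sub_norm_sq {E : Type*} [NormedAddCommGroup E] {ρ : ℝ} (hρ : 0 ≤ ρ) :
    LipschitzWith (2 * ρ).toNNReal fun y : E ↦ max (ρ ^ 2 - ‖y‖ ^ 2) 0 := by
  have h (y : E) : max (ρ ^ 2 - ‖y‖ ^ 2) 0 = ρ ^ 2 - min ‖y‖ ρ ^ 2 := by
    rcases le_total ‖y‖ ρ with hy | hy
    · rw [min_eq_left hy, max_eq_left]
      nlinarith [norm_nonneg y]
    · rw [min_eq_right hy, max_eq_right, sub_self]
      nlinarith [norm_nonneg y]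
  refine LipschitzWith.of_dist_le_mul fun y z ↦ ?_
  rw [Real.coe_toNNReal _ (by positivity), h, h, Real.dist_eq]
  have hmin : |min ‖z‖ ρ - min ‖y‖ ρ| ≤ dist y z := by
    refine (abs_min_sub_min_le_max _ _ _ _).trans ?_
    rw [sub_self, abs_zero, max_eq_left (abs_nonneg _), dist_comm, dist_eq_norm]
    exact abs_norm_sub_norm_le z y
  have hy : 0 ≤ min ‖y‖ ρ := le_min (norm_nonneg y) hρ
  have hz : 0 ≤ min ‖z‖ ρ := le_min (norm_nonneg z) hρ
  have hsum : |min ‖z‖ ρ + min ‖y‖ ρ| ≤ 2 * ρ := by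
    rw [abs_of_nonneg (by positivity)]
    linarith [min_le_right ‖y‖ ρ, min_le_right ‖z‖ ρ]
  calc |ρ ^ 2 - min ‖y‖ ρ ^ 2 - (ρ ^ 2 - min ‖z‖ ρ ^ 2)|
      = |min ‖z‖ ρ + min ‖y‖ ρ| * |min ‖z‖ ρ - min ‖y‖ ρ| := by rw [← abs_mul]; ring_nf
    _ ≤ 2 * ρ * dist y z := by gcongr

/-- The derivative of the weight off the sphere `‖y‖ = ρ`, where the weight has a corner. -/
lemma lineDeriv_max_sq_sub_norm_sq {E : Type*} [NormedAddCommGroup E] [InnerProductSpace ℝ E]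
    {ρ : ℝ} (hρ : 0 ≤ ρ) {y : E} (hy : ‖y‖ ≠ ρ) (e : E) :
    lineDeriv ℝ (fun y : E ↦ max (ρ ^ 2 - ‖y‖ ^ 2) 0) y (-e) =
      (ball (0 : E) ρ).indicator (fun y ↦ 2 * ⟪e, y⟫_ℝ) y := by
  rcases hy.lt_or_gt with hy | hy
  · rw [indicator_of_mem (by simpa using hy)]
    have h1 : HasFDerivAt (fun y : E ↦ ρ ^ 2 - ‖y‖ ^ 2) (-(2 • innerSL ℝ y)) y :=
      (hasStrictFDerivAt_norm_sq y).hasFDerivAt.const_sub _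
    have h2 : (fun y : E ↦ max (ρ ^ 2 - ‖y‖ ^ 2) 0) =ᶠ[𝓝 y] fun y ↦ ρ ^ 2 - ‖y‖ ^ 2 := by
      filter_upwards [continuous_norm.continuousAt.eventually_lt continuousAt_const hy] with z hz
      exact max_eq_left (by nlinarith [norm_nonneg z])
    rw [((h1.congr_of_eventuallyEq h2).hasLineDerivAt (-e)).lineDeriv]
    simp [real_inner_comm]
  · rw [indicator_of_notMem (by simpa using hy.le)]
    have h2 : (fun y : E ↦ max (ρ ^ 2 - ‖y‖ ^ 2) 0) =ᶠ[𝓝 y] fun _ ↦ 0 := by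
      filter_upwards [continuousAt_const.eventually_lt continuous_norm.continuousAt hy] with z hz
      exact max_eq_right (by nlinarith [norm_nonneg z])
    exact (((hasFDerivAt_const (0 : ℝ) y).congr_of_eventuallyEq h2).hasLineDerivAt (-e)).lineDeriv

/-! ### Spherical integrals and Green's identity -/

section Sphere

variable {E : Type*} [NormedAddCommGroup E] [InnerProductSpace ℝ E] [MeasurableSpace E]
  (ν : Measure E)

/-- The integral of `F` over the sphere of radius `s` about `0`, in the parametrisation by the unit
sphere and without the Jacobian factor `s ^ (dim E - 1)`. -/
noncomputable def sphereIntegral (F : E → ℝ) (s : ℝ) : ℝ :=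
  ∫ ω : sphere (0 : E) 1, F (s • (ω : E)) ∂ν.toSphere

lemma sphereIntegral_congr {F G : E → ℝ} {s : ℝ} (hs : 0 ≤ s) (h : ∀ y, ‖y‖ = s → F y = G y) :
    sphereIntegral ν F s = sphereIntegral ν G s := by
  refine integral_congr_ae (.of_forall fun ω ↦ h _ ?_)
  simp [norm_smul, abs_of_nonneg hs]

variable [FiniteDimensional ℝ E] [BorelSpace E] [ν.IsAddHaarMeasure]

lemma continuous_sphereIntegral {F : E → ℝ} (hF : Continuous F) :
    Continuous (sphereIntegral ν F) := by
  have : Continuous (Function.uncurry fun (s : ℝ) (ω : sphere (0 : E) 1) ↦ F (s • (ω : E))) := by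
    simp only [Function.uncurry_def]
    fun_prop
  have := continuous_parametric_integral_of_continuous (μ := ν.toSphere) this isCompact_univ
  rwa [Measure.restrict_univ] at this

lemma hasDerivAt_sphereIntegral {F : E → ℝ} (hF : ContDiff ℝ 1 F) (s : ℝ) :
    HasDerivAt (sphereIntegral ν F)
      (∫ ω : sphere (0 : E) 1, fderiv ℝ F (s • (ω : E)) ω ∂ν.toSphere) s := by
  have hF' : Continuous (fderiv ℝ F) := hF.continuous_fderiv one_ne_zero
  have hc : Continuous fun p : ℝ × sphere (0 : E) 1 ↦ fderiv ℝ F (p.1 • (p.2 : E)) p.2 := by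
    fun_prop
  obtain ⟨C, hC⟩ := ((isCompact_closedBall s 1).prod isCompact_univ).exists_bound_of_continuousOn
    hc.continuousOn
  refine (hasDerivAt_integral_of_dominated_loc_of_deriv_le
    (F' := fun t (ω : sphere (0 : E) 1) ↦ fderiv ℝ F (t • (ω : E)) ω)
    (closedBall_mem_nhds s one_pos) (.of_forall fun t ↦ ?_) ?_ ?_
    (.of_forall fun ω t ht ↦ hC (t, ω) ⟨ht, mem_univ _⟩) (integrable_const C)
    (.of_forall fun ω t _ ↦ ?_)).2
  · have := hF.continuous
    exact Continuous.aestronglyMeasurable (by fun_prop)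
  · have := hF.continuous
    exact Continuous.integrable_of_hasCompactSupport (by fun_prop) (.of_compactSpace _)
  · exact Continuous.aestronglyMeasurable (by fun_prop)
  · have h1 : HasDerivAt (fun t : ℝ ↦ t • (ω : E)) (ω : E) t := by
      simpa using (hasDerivAt_id t).smul_const (ω : E)
    exact ((hF.differentiable one_ne_zero _).hasFDerivAt.comp_hasDerivAt t h1)

/-- Integration in polar coordinates over a ball about the origin. -/
lemma setIntegral_ball_eq_integral_sphereIntegral [Nontrivial E] {F : E → ℝ} (hF : Continuous F)
    {ρ : ℝ} (hρ : 0 ≤ ρ) :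
    ∫ y in ball 0 ρ, F y ∂ν =
      ∫ s in 0..ρ, s ^ (Module.finrank ℝ E - 1) * sphereIntegral ν F s := by
  set n := Module.finrank ℝ E - 1
  set G : E → ℝ := (ball (0 : E) ρ).indicator F
  have hG : Integrable G ν :=
    ((hF.continuousOn.integrableOn_compact (isCompact_closedBall 0 ρ)).mono_set
      ball_subset_closedBall).integrable_indicator measurableSet_ball
  set H : sphere (0 : E) 1 × Ioi (0 : ℝ) → ℝ := fun p ↦ G (p.2.1 • (p.1 : E))
  have hmp := ν.measurePreserving_homeomorphUnitSphereProd
  have hemb := (homeomorphUnitSphereProd E).measurableEmbedding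
  have hH (x : ({0}ᶜ : Set E)) : H (homeomorphUnitSphereProd E x) = G x := by
    have : (x : E) ≠ 0 := x.2
    simp [H, smul_smul, this]
  have hHint : Integrable H (ν.toSphere.prod (.volumeIoiPow n)) := by
    rw [← hmp.integrable_comp_emb hemb]
    simp only [Function.comp_def, hH]
    exact ((integrableOn_iff_comap_subtypeVal (measurableSet_singleton 0).compl).1
      hG.integrableOn)
  calc
    ∫ y in ball 0 ρ, F y ∂ν = ∫ y, G y ∂ν := (integral_indicator measurableSet_ball).symm
    _ = ∫ x : ({0}ᶜ : Set E), G x ∂(ν.comap (↑)) := by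
      rw [integral_subtype_comap (measurableSet_singleton _).compl G, restrict_compl_singleton]
    _ = ∫ p, H p ∂(ν.toSphere.prod (.volumeIoiPow n)) := by
      rw [← hmp.integral_comp hemb]
      simp only [hH]
    _ = ∫ s : Ioi (0 : ℝ), sphereIntegral ν G s ∂(.volumeIoiPow n) :=
      integral_prod_symm _ hHint
    _ = ∫ s in Ioi (0 : ℝ), s ^ n * sphereIntegral ν G s := by
      simp only [Measure.volumeIoiPow, ENNReal.ofReal]
      rw [integral_withDensity_eq_integral_smul
          ((measurable_subtype_coe.pow_const _).real_toNNReal),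
        integral_subtype_comap measurableSet_Ioi
          fun s ↦ Real.toNNReal (s ^ n) • sphereIntegral ν G s]
      refine setIntegral_congr_fun measurableSet_Ioi fun s hs ↦ ?_
      simp only [NNReal.smul_def, smul_eq_mul]
      rw [Real.coe_toNNReal _ (pow_nonneg (mem_Ioi.1 hs).le _)]
    _ = ∫ s in Ioi (0 : ℝ), (Iio ρ).indicator (fun s ↦ s ^ n * sphereIntegral ν F s) s := by
      refine setIntegral_congr_fun measurableSet_Ioi fun s (hs : 0 < s) ↦ ?_
      by_cases hsρ : s < ρ
      · simp only [mem_Iio, hsρ, indicator_of_mem]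
        rw [sphereIntegral_congr ν hs.le fun y hy ↦
          indicator_of_mem (by simpa [hy] using hsρ) F]
      · simp only [mem_Iio, hsρ, not_false_eq_true, indicator_of_notMem]
        rw [sphereIntegral_congr ν (G := fun _ ↦ 0) hs.le fun y hy ↦
          indicator_of_notMem (by simpa [hy] using hsρ) F]
        simp [sphereIntegral]
    _ = ∫ s in 0..ρ, s ^ n * sphereIntegral ν F s := by
      rw [setIntegral_indicator measurableSet_Iio, Ioi_inter_Iio,
        intervalIntegral.integral_of_le hρ, integral_Ioc_eq_integral_Ioo]

/-- **Green's identity on a ball**, tested against the weight `ρ² - ‖y‖²`. The weight vanishes on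
the boundary sphere, so no boundary term occurs. -/
lemma integral_sq_sub_norm_sq_mul_laplacian [Nontrivial E] {v : E → ℝ} (hv : ContDiff ℝ 2 v)
    (hvc : HasCompactSupport v) {ρ : ℝ} (hρ : 0 ≤ ρ) :
    ∫ y in ball 0 ρ, (ρ ^ 2 - ‖y‖ ^ 2) * (Δ v) y ∂ν =
      2 * ∫ y in ball 0 ρ, fderiv ℝ v y y ∂ν := by
  set b := stdOrthonormalBasis ℝ E
  set g : E → ℝ := fun y ↦ max (ρ ^ 2 - ‖y‖ ^ 2) 0
  have hv1 : ContDiff ℝ 1 (fderiv ℝ v) := hv.fderiv_right (by norm_num)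
  have hlip := lipschitzWith_max_sq_sub_norm_sq (E := E) hρ
  have hgc : HasCompactSupport g := by
    refine .intro (isCompact_closedBall (0 : E) ρ) fun y hy ↦ max_eq_right ?_
    have : ρ < ‖y‖ := by simpa using hy
    nlinarith
  have hbdd {F : E → ℝ} (hF : Continuous F) : IntegrableOn F (ball 0 ρ) ν :=
    (hF.continuousOn.integrableOn_compact (isCompact_closedBall 0 ρ)).mono_set
      ball_subset_closedBall
  have hD2 (i) : Continuous fun y ↦ iteratedFDeriv ℝ 2 v y ![b i, b i] := by
    have : Continuous (iteratedFDeriv ℝ 2 v) := hv.continuous_iteratedFDeriv (by norm_num)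
    fun_prop
  have hD1 : Continuous (fderiv ℝ v) := hv1.continuous
  -- Integration by parts in the direction `b i`.
  have key (i) : ∫ y in ball 0 ρ, (ρ ^ 2 - ‖y‖ ^ 2) * iteratedFDeriv ℝ 2 v y ![b i, b i] ∂ν =
      ∫ y in ball 0 ρ, 2 * (⟪b i, y⟫_ℝ * fderiv ℝ v y (b i)) ∂ν := by
    set f : E → ℝ := fun y ↦ fderiv ℝ v y (b i)
    have hf : ContDiff ℝ 1 f := hv1.clm_apply contDiff_const
    obtain ⟨C, hC⟩ := hf.lipschitzWith_of_hasCompactSupport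
      (hvc.fderiv_apply ℝ (b i)) one_ne_zero
    have hlf (y) : lineDeriv ℝ f y (b i) = iteratedFDeriv ℝ 2 v y ![b i, b i] := by
      rw [(hf.differentiable one_ne_zero y).lineDeriv_eq_fderiv, iteratedFDeriv_two_apply,
        fderiv_clm_apply (hv1.differentiable one_ne_zero y) (differentiableAt_const _)]
      simp
    have hparts := LipschitzWith.integral_lineDeriv_mul_eq (μ := ν) hC hlip hgc (b i)
    calc
      _ = ∫ y, lineDeriv ℝ f y (b i) * g y ∂ν := by
        rw [← integral_indicator measurableSet_ball]
        congr 1 with y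
        by_cases hy : ‖y‖ < ρ
        · rw [indicator_of_mem (by simpa using hy), hlf, mul_comm]
          simp only [g]
          rw [max_eq_left (by nlinarith [norm_nonneg y])]
        · rw [indicator_of_notMem (by simpa using hy)]
          simp only [g]
          rw [max_eq_right (by nlinarith), mul_zero]
      _ = ∫ y, lineDeriv ℝ g y (-b i) * f y ∂ν := hparts
      _ = ∫ y, (ball (0 : E) ρ).indicator (fun y ↦ 2 * (⟪b i, y⟫_ℝ * fderiv ℝ v y (b i))) y ∂ν := by
        refine integral_congr_ae ?_
        have hnull : ∀ᵐ y ∂ν, y ∉ sphere (0 : E) ρ :=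
          measure_eq_zero_iff_ae_notMem.1 (Measure.addHaar_sphere ν 0 ρ)
        filter_upwards [hnull] with y hy
        rw [lineDeriv_max_sq_sub_norm_sq hρ (by simpa using hy)]
        by_cases h : y ∈ ball (0 : E) ρ
        · simp only [h, indicator_of_mem, f]
          ring
        · simp only [h, not_false_eq_true, indicator_of_notMem, zero_mul]
      _ = _ := integral_indicator measurableSet_ball
  calc
    _ = ∫ y in ball 0 ρ, ∑ i, (ρ ^ 2 - ‖y‖ ^ 2) * iteratedFDeriv ℝ 2 v y ![b i, b i] ∂ν := by
      simp only [InnerProductSpace.laplacian_eq_iteratedFDeriv_orthonormalBasis v b,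
        Finset.mul_sum]
    _ = ∑ i, ∫ y in ball 0 ρ, 2 * (⟪b i, y⟫_ℝ * fderiv ℝ v y (b i)) ∂ν := by
      rw [integral_finsetSum _ fun i _ ↦ hbdd (by have := hD2 i; fun_prop)]
      exact Finset.sum_congr rfl fun i _ ↦ key i
    _ = ∫ y in ball 0 ρ, 2 * fderiv ℝ v y y ∂ν := by
      rw [← integral_finsetSum _ fun i _ ↦ hbdd (by fun_prop)]
      congr 1 with y
      rw [← Finset.mul_sum]
      nth_rw 4 [← b.sum_repr' y]
      simp only [map_sum, map_smul, smul_eq_mul]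
    _ = _ := integral_const_mul _ _

end Sphere

/-! ### The radial equation -/

/-- A solution `φ` of the integrated radial equation `s ^ (m - 1) φ' = μ² ∫₀ˢ t ^ (m - 1) φ`,
continuous at `0`, is `φ 0` times `sphereCoeff m (μ * ·)`, the solution with value `1` at `0`.
Uniqueness is read off from the Wronskian of the two solutions, which vanishes at `0`. The vanishing
of the Wronskian is itself the second conclusion. -/
lemma radial_solution {m : ℕ} (hm : 2 ≤ m) (μ : ℝ) {φ D : ℝ → ℝ} {r : ℝ} (hr : 0 < r)
    (hφ : Continuous φ) (hD : ∀ s ∈ Ioo 0 r, HasDerivAt φ (D s) s)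
    (hode : ∀ s ∈ Ioo 0 r, s ^ (m - 1) * D s = μ ^ 2 * ∫ t in 0..s, t ^ (m - 1) * φ t) :
    φ r = sphereCoeff m (μ * r) * φ 0 ∧
      (∫ t in 0..r, t ^ (m - 1) * φ t) * sphereCoeff m (μ * r) =
        φ r * (r ^ m * ballCoeff m (μ * r) / m) := by
  set G : ℝ → ℝ := fun s ↦ ∫ t in 0..s, t ^ (m - 1) * φ t
  set A : ℝ → ℝ := fun s ↦ sphereCoeff m (μ * s)
  set B : ℝ → ℝ := fun s ↦ ballCoeff m (μ * s)
  have hm0 : (m : ℝ) ≠ 0 := by positivity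
  have hpow (s : ℝ) : s ^ m = s * s ^ (m - 1) := by
    rw [← pow_succ', Nat.sub_add_cancel (by omega)]
  have hG (s : ℝ) : HasDerivAt G (s ^ (m - 1) * φ s) s :=
    intervalIntegral.integral_hasDerivAt_right
      (Continuous.intervalIntegrable (by fun_prop) _ _)
      (Continuous.stronglyMeasurableAtFilter (by fun_prop) _ _)
      (Continuous.continuousAt (by fun_prop))
  have hA (s : ℝ) : HasDerivAt A (μ ^ 2 * s * B s / m) s := hasDerivAt_sphereCoeff hm μ s
  have hB (s : ℝ) : HasDerivAt (fun s ↦ s ^ m * B s / m) (s ^ (m - 1) * A s) s := by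
    refine ((hasDerivAt_pow_mul_ballCoeff hm μ s).div_const (m : ℝ)).congr_deriv ?_
    field_simp
    rfl
  have hApos (s : ℝ) : 0 < A s := sphereCoeff_pos hm _
  have hGc : Continuous G := continuous_iff_continuousAt.2 fun s ↦ (hG s).continuousAt
  have hAc : Continuous A := continuous_iff_continuousAt.2 fun s ↦ (hA s).continuousAt
  have hBc : Continuous fun s ↦ s ^ m * B s / m :=
    continuous_iff_continuousAt.2 fun s ↦ (hB s).continuousAt
  -- Multiplied by `μ²`, the difference of the two sides is the weighted Wronskian
  -- `ρ ^ (m - 1) * (φ' * A - φ * A')`.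
  have hW {ρ : ℝ} (hρ : ρ ∈ Ioc 0 r) : G ρ * A ρ = φ ρ * (ρ ^ m * B ρ / m) := by
    obtain ⟨c, hc, hslope⟩ := exists_hasDerivAt_eq_slope
      (fun s ↦ G s * A s - φ s * (s ^ m * B s / m)) (fun _ ↦ 0) hρ.1
      (Continuous.continuousOn (by fun_prop)) fun s hs ↦ by
        have hs' : s ∈ Ioo 0 r := ⟨hs.1, hs.2.trans_le hρ.2⟩
        refine (((hG s).mul (hA s)).sub ((hD s hs').mul (hB s))).congr_deriv ?_
        have h := hode s hs'
        change _ = μ ^ 2 * G s at h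
        rw [hpow]
        linear_combination (- s * B s / m) * h
    have h0 : G 0 = 0 := intervalIntegral.integral_same
    have hm1 : m ≠ 0 := by omega
    rw [eq_div_iff (sub_pos.2 hρ.1).ne'] at hslope
    simp only [h0, ne_eq, hm1, not_false_eq_true, zero_pow, zero_mul, zero_div,
      mul_zero, sub_zero] at hslope
    exact sub_eq_zero.1 hslope.symm
  refine ⟨?_, hW ⟨hr, le_rfl⟩⟩
  -- The quotient is constant, by the mean value theorem, which needs no derivative at `0`.
  obtain ⟨c, hc, hslope⟩ := exists_hasDerivAt_eq_slope
    (fun s ↦ φ s / A s) (fun _ ↦ 0) hr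
    (Continuous.continuousOn (hφ.div hAc fun s ↦ (hApos s).ne')) fun s hs ↦ by
      refine ((hD s hs).div (hA s) (hApos s).ne').congr_deriv ?_
      have h := hode s hs
      change _ = μ ^ 2 * G s at h
      have hw := hW ⟨hs.1, hs.2.le⟩
      rw [hpow] at hw
      have hs0 : s ^ (m - 1) ≠ 0 := pow_ne_zero _ hs.1.ne'
      rw [div_eq_zero_iff]
      left
      apply mul_left_cancel₀ hs0
      linear_combination A s * h + μ ^ 2 * hw
  rw [eq_div_iff (sub_pos.2 hr).ne'] at hslope
  have hA0 : A 0 = 1 := by simp [A, sphereCoeff_zero hm]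
  have := hApos r
  rw [hA0, zero_mul, div_one, eq_comm, sub_eq_zero, div_eq_iff this.ne'] at hslope
  rw [hslope, mul_comm]

/-! ### The radial equation for spherical integrals -/

section Sphere

variable {E : Type*} [NormedAddCommGroup E] [InnerProductSpace ℝ E] [FiniteDimensional ℝ E]
  [MeasurableSpace E] [BorelSpace E] (ν : Measure E) [ν.IsAddHaarMeasure]

/-- The integrated radial equation for the spherical integrals of a solution of `Δ v = κ v`, that
is, the divergence theorem for `∇v` on the ball of radius `ρ`. -/
lemma pow_mul_deriv_sphereIntegral [Nontrivial E] {v : E → ℝ} (hv : ContDiff ℝ 2 v)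
    (hvc : HasCompactSupport v) {κ r : ℝ} (hκ : ∀ y ∈ ball (0 : E) r, (Δ v) y = κ * v y)
    {ρ : ℝ} (hρ : ρ ∈ Ioo 0 r) :
    ρ ^ (Module.finrank ℝ E - 1) * ∫ ω : sphere (0 : E) 1, fderiv ℝ v (ρ • (ω : E)) ω ∂ν.toSphere =
      κ * ∫ s in 0..ρ, s ^ (Module.finrank ℝ E - 1) * sphereIntegral ν v s := by
  set n := Module.finrank ℝ E - 1
  set f : ℝ → ℝ := fun s ↦ s ^ n * sphereIntegral ν v s
  set h : ℝ → ℝ := fun s ↦ s ^ n * sphereIntegral ν (fun y ↦ fderiv ℝ v y y) s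
  have hD1 : Continuous (fderiv ℝ v) := hv.continuous_fderiv two_ne_zero
  have hvc' : Continuous v := hv.continuous
  have hSv := continuous_sphereIntegral ν hvc'
  have hSh := continuous_sphereIntegral ν (F := fun y ↦ fderiv ℝ v y y) (by fun_prop)
  have hf : Continuous f := by fun_prop
  have hh : Continuous h := by fun_prop
  -- The weighted Green identity in polar coordinates; differentiating it in `s` removes the weight.
  have key : ∀ s ∈ Ioo 0 r,
      κ * (s ^ 2 * (∫ t in 0..s, f t) - ∫ t in 0..s, t ^ 2 * f t) = 2 * ∫ t in 0..s, h t := by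
    intro s hs
    have hgreen := integral_sq_sub_norm_sq_mul_laplacian ν hv hvc hs.1.le
    rw [setIntegral_congr_fun (g := fun y ↦ κ * ((s ^ 2 - ‖y‖ ^ 2) * v y)) measurableSet_ball
      fun y hy ↦ by
        simp only
        rw [hκ y (ball_subset_ball hs.2.le hy)]
        ring,
      integral_const_mul,
      setIntegral_ball_eq_integral_sphereIntegral ν (by fun_prop) hs.1.le,
      setIntegral_ball_eq_integral_sphereIntegral ν (by fun_prop) hs.1.le] at hgreen
    rw [← hgreen, ← intervalIntegral.integral_const_mul, ← intervalIntegral.integral_sub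
      (Continuous.intervalIntegrable (by fun_prop) _ _)
      (Continuous.intervalIntegrable (by fun_prop) _ _)]
    congr 1
    refine intervalIntegral.integral_congr fun t ht ↦ ?_
    rw [uIcc_of_le hs.1.le] at ht
    rw [sphereIntegral_congr ν (G := fun y ↦ (s ^ 2 - t ^ 2) * v y) ht.1 fun y hy ↦ by rw [hy]]
    simp only [sphereIntegral, integral_const_mul, f]
    ring
  have hint {g : ℝ → ℝ} (hg : Continuous g) : HasDerivAt (fun s ↦ ∫ t in 0..s, g t) (g ρ) ρ :=
    intervalIntegral.integral_hasDerivAt_right (hg.intervalIntegrable _ _)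
      (hg.stronglyMeasurableAtFilter _ _) hg.continuousAt
  have h1 := (((hasDerivAt_pow 2 ρ).mul (hint hf)).sub
    (hint (g := fun t ↦ t ^ 2 * f t) (by fun_prop))).const_mul κ
  have h2 := (hint hh).const_mul 2
  have heq := h1.unique (h2.congr_of_eventuallyEq (by
    filter_upwards [isOpen_Ioo.mem_nhds hρ] with s hs using key s hs))
  have hhρ : h ρ = ρ * (ρ ^ n *
      ∫ ω : sphere (0 : E) 1, fderiv ℝ v (ρ • (ω : E)) ω ∂ν.toSphere) := by
    simp only [h, sphereIntegral, map_smul, smul_eq_mul, integral_const_mul]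
    ring
  rw [hhρ] at heq
  apply mul_left_cancel₀ (mul_ne_zero two_ne_zero hρ.1.ne')
  simp only [Nat.cast_ofNat] at heq
  linear_combination - heq

end Sphere

/-! ### Mean values of panharmonic functions -/

/-- A function that is `C²` near a closed ball agrees near that ball with a compactly supported
`C²` function. -/
lemma exists_contDiff_hasCompactSupport_eqOn {E : Type*} [NormedAddCommGroup E]
    [InnerProductSpace ℝ E] [FiniteDimensional ℝ E] {D : Set E} (hD : IsOpen D) {u : E → ℝ}
    (hu : ContDiffOn ℝ 2 u D) {x : E} {r : ℝ} (hr : 0 < r) (hrD : closedBall x r ⊆ D) :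
    ∃ v : E → ℝ, ContDiff ℝ 2 v ∧ HasCompactSupport v ∧ ∃ R > r, EqOn v u (ball x R) := by
  obtain ⟨δ, hδ, hsub⟩ := (isCompact_closedBall x r).exists_cthickening_subset_open hD hrD
  rw [cthickening_closedBall hδ.le hr.le] at hsub
  let χ : ContDiffBump x := ⟨r + δ / 2, r + δ, by positivity, by linarith⟩
  refine ⟨fun y ↦ χ y * u y, ?_, χ.hasCompactSupport.mul_right, r + δ / 2, by linarith,
    fun y hy ↦ ?_⟩
  · rw [← contMDiff_iff_contDiff]
    refine contMDiff_of_tsupport fun y hy ↦ ContDiffAt.contMDiffAt ?_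
    have hyD : y ∈ D := by
      have h1 := tsupport_mul_subset_left hy
      rw [χ.tsupport_eq] at h1
      exact hsub (by simpa [add_comm] using h1)
    exact χ.contDiffAt.mul (hu.contDiffAt (hD.mem_nhds hyD))
  · simp [χ.one_of_mem_closedBall (ball_subset_closedBall hy)]

/-- The mean value identities for solutions of `Δ u = μ² u`, with real coefficients and for an
arbitrary Haar measure on an inner product space of dimension `m ≥ 2`. -/
theorem average_ball_of_laplacian_eq {E : Type*} [NormedAddCommGroup E] [InnerProductSpace ℝ E]
    [FiniteDimensional ℝ E] [MeasurableSpace E] [BorelSpace E] (ν : Measure E) [ν.IsAddHaarMeasure]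
    {m : ℕ} (hm : 2 ≤ m) (hd : Module.finrank ℝ E = m) (μ : ℝ) {D : Set E} (hD : IsOpen D)
    {u : E → ℝ} (hu : ContDiffOn ℝ 2 u D) (hΔ : ∀ y ∈ D, (Δ u) y = μ ^ 2 * u y)
    {x : E} {r : ℝ} (hr0 : 0 < r) (hrD : closedBall x r ⊆ D) :
    ⨍ y in ball x r, u y ∂ν = ballCoeff m (μ * r) * u x ∧
      sphereCoeff m (μ * r) * (⨍ y in ball x r, u y ∂ν) = ballCoeff m (μ * r) *
        ⨍ ω : sphere (0 : E) 1, u (x + r • (ω : E)) ∂ν.toSphere := by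
  obtain ⟨w, hw, hwc, R, hR, hwu⟩ :=
    exists_contDiff_hasCompactSupport_eqOn hD hu hr0 hrD
  set v : E → ℝ := fun y ↦ w (x + y)
  have hv : ContDiff ℝ 2 v := hw.comp (contDiff_const.add contDiff_id)
  have hvc : HasCompactSupport v := hwc.comp_homeomorph (Homeomorph.addLeft x)
  have hvu {y : E} (hy : ‖y‖ ≤ r) : v y = u (x + y) := hwu (by simpa using hy.trans_lt hR)
  -- The translate `v` solves the equation on the ball about `0`, where it agrees with `u (x + ·)`.
  have hlap : ∀ y ∈ ball (0 : E) r, (Δ v) y = μ ^ 2 * v y := by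
    intro y hy
    have hy' : x + y ∈ ball x R := by simpa using (mem_ball_zero_iff.1 hy).trans hR
    have h1 : (Δ v) y = (Δ w) (x + y) := by
      simp only [InnerProductSpace.laplacian_eq_iteratedFDeriv_stdOrthonormalBasis, v,
        iteratedFDeriv_comp_add_left]
    have h2 : (Δ w) (x + y) = (Δ u) (x + y) :=
      (InnerProductSpace.laplacian_congr_nhds
        (Filter.eventuallyEq_of_mem (isOpen_ball.mem_nhds hy') hwu)).self_of_nhds
    have h3 := hΔ (x + y) (hrD (by simpa using (mem_ball_zero_iff.1 hy).le))
    rw [h1, h2, hvu (mem_ball_zero_iff.1 hy).le, h3]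
  set N := ⨍ y in ball x r, u y ∂ν
  set P := ⨍ ω : sphere (0 : E) 1, u (x + r • (ω : E)) ∂ν.toSphere
  have : Nontrivial E := Module.nontrivial_of_finrank_pos (R := ℝ) (by rw [hd]; omega)
  set c := ν.toSphere.real Set.univ
  obtain ⟨hφ, hG⟩ := radial_solution hm μ hr0
    (continuous_sphereIntegral ν hv.continuous)
    (fun s _ ↦ hasDerivAt_sphereIntegral ν (hv.of_le (by norm_num)) s)
    (fun s hs ↦ by simpa only [hd] using pow_mul_deriv_sphereIntegral ν hv hvc hlap hs)
  have hc : c = m * ν.real (ball 0 1) := by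
    rw [← hd]
    exact Measure.toSphere_real_apply_univ _
  have hc0 : 0 < c := by
    rw [hc]
    have : 0 < ν.real (ball 0 1) :=
      ENNReal.toReal_pos (measure_ball_pos _ _ one_pos).ne' measure_ball_lt_top.ne
    positivity
  have hm0 : (m : ℝ) ≠ 0 := by positivity
  have h0 : sphereIntegral ν v 0 = c * u x := by
    simp [sphereIntegral, hvu (y := 0) (by simpa using hr0.le), c]
  have hS : sphereIntegral ν v r = c * P := by
    rw [sphereIntegral_congr ν (G := fun y ↦ u (x + y)) hr0.le fun y hy ↦ hvu hy.le,
      show P = _ from average_eq _ _, smul_eq_mul, mul_inv_cancel_left₀ hc0.ne']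
    rfl
  have hB : ∫ t in 0..r, t ^ (m - 1) * sphereIntegral ν v t =
      c * r ^ m / m * N := by
    have hvol : ν.real (ball x r) = c * r ^ m / m := by
      rw [measureReal_def, Measure.addHaar_ball _ _ hr0.le, ENNReal.toReal_mul,
        ENNReal.toReal_ofReal (by positivity), ← measureReal_def, hd, hc]
      field_simp
    have h1 : ∫ t in 0..r, t ^ (m - 1) * sphereIntegral ν v t = ∫ y in ball (0 : E) r, v y ∂ν := by
      rw [setIntegral_ball_eq_integral_sphereIntegral ν hv.continuous hr0.le, hd]
    have h2 : ∫ y in ball (0 : E) r, v y ∂ν = ∫ y in ball x r, u y ∂ν := by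
      rw [setIntegral_congr_fun measurableSet_ball fun y hy ↦ hvu (mem_ball_zero_iff.1 hy).le]
      have := (measurePreserving_add_left ν x).setIntegral_preimage_emb
        (measurableEmbedding_addLeft x) u (ball x r)
      rwa [preimage_add_ball, sub_self] at this
    rw [h1, h2, show N = _ from setAverage_eq _ _ _, hvol, smul_eq_mul, mul_inv_cancel_left₀]
    positivity
  rw [h0, hS] at hφ
  rw [hB, hS] at hG
  have hA0 := sphereCoeff_pos hm (μ * r)
  have hsphere : P = sphereCoeff m (μ * r) * u x :=
    mul_left_cancel₀ hc0.ne' (by linear_combination hφ)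
  have hratio : sphereCoeff m (μ * r) * N =
      ballCoeff m (μ * r) * P := by
    have : c * r ^ m / m ≠ 0 := by positivity
    apply mul_left_cancel₀ this
    linear_combination hG
  refine ⟨?_, hratio⟩
  apply mul_left_cancel₀ hA0.ne'
  rw [hratio, hsphere]
  ring

end Panharmonic

theorem corollary2p2 (m : ℕ) (hm : 2 ≤ m) (μ : ℝ) (hμ : μ ≠ 0)
    (D : Set (EuclideanSpace ℝ (Fin m))) (hD_open : IsOpen D) (hD_conn : IsConnected D)
    (u : EuclideanSpace ℝ (Fin m) → ℝ) (hu : Panharmonic.IsPanharmonicOn μ u D)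
    (x : EuclideanSpace ℝ (Fin m)) (r : ℝ) (hr : Panharmonic.IsAdmissibleBall D x r) :
    (Panharmonic.ballMean u x r : ℂ) = Panharmonic.aBall m (μ * r) * (u x : ℂ) ∧
    Panharmonic.aSphere m (μ * r) * (Panharmonic.ballMean u x r : ℂ) =
      Panharmonic.aBall m (μ * r) * (Panharmonic.sphereMean u x r : ℂ) := by
  obtain ⟨hr0, hrD⟩ := hr
  rw [closure_ball x hr0.ne'] at hrD
  have hμr : μ * r ≠ 0 := mul_ne_zero hμ hr0.ne'
  obtain ⟨hball, hratio⟩ :=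
    Panharmonic.average_ball_of_laplacian_eq volume hm (by simp) μ
      hD_open hu.1 (fun y hy ↦ sub_eq_zero.1 (hu.2 y hy)) hr0 hrD
  rw [Panharmonic.aBall_eq_ballCoeff m hμr, Panharmonic.aSphere_eq_sphereCoeff m hμr]
  exact ⟨mod_cast hball, mod_cast hratio⟩
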